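/- Let $R$ be a GCD domain (an integral domain in which any two elements have a greatest common divisor). Let $G$ be a finite simple graph with vertices $v_1,\dots,v_n$, not necessarily connected, and let each edge $e$ of $G$ be labeled by a nonzero principal ideal $\alpha(e)=(l_e)$ of $R$, where $l_e$ is any chosen generator. The module of generalized splines is $$R_{(G,\alpha)}=\{F\in R^{V(G)} : F(u)-F(v)\in\alpha(uv)\text{ for every edge }uv\text{ of }G\}.$$ A zero trail of $v_i$ is a trail (a walk with no repeated edge) in $G$ from $v_i$ to some $v_j$ with $j<i$. Let $\mathscr{L}_i\in R$ be the least common multiple, over all zero trails $p$ of $v_i$, of the greatest common divisor of the labels $l_e$ of the edges $e$ on $p$, where the least common multiple of the empty family is $1$ (so $\mathscr{L}_1=1$), and let $Q_G=\prod_{i=1}^n\mathscr{L}_i$; it is determined up to a unit of $R$. For $F_1,\dots,F_n\in R_{(G,\alpha)}$ let $|F_1\ F_2\ \cdots\ F_n|$ denote the determinant of the $n\times n$ matrix whose $c$-th column is $(F_c(v_n),\dots,F_c(v_2),F_c(v_1))^{T}$. Then, for all $F_1,\dots,F_n\in R_{(G,\alpha)}$, the elements $F_1,\dots,F_n$ form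 an $R$-module basis of $R_{(G,\alpha)}$ if and only if $|F_1\ F_2\ \cdots\ F_n|=r\cdot Q_G$ for some unit $r\in R$. -/

import Mathlib

namespace GenSpline

/-- The `R`-module of generalized splines on the edge-labeled graph `(G, α)`, where `α` labels the
edges of `G` by ideals of `R`: all vertex labelings `F` with `F u - F v ∈ α(uv)` for every edge
`uv`. The module structure is the componentwise one. -/
def splineModule {V R : Type*} [CommRing R] (G : SimpleGraph V) (α : G.EdgeLabeling (Ideal R)) :
    Submodule R (V → R) where
  carrier := {F | ∀ (u v : V) (h : G.Adj u v), F u - F v ∈ α ⟨s(u, v), h⟩}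
  zero_mem' := by
    intro u v h
    simp
  add_mem' := by
    intro F F' hF hF' u v h
    have := (α ⟨s(u, v), h⟩).add_mem (hF u v h) (hF' u v h)
    simpa only [Pi.add_apply, add_sub_add_comm] using this
  smul_mem' := by
    intro r F hF u v h
    have := (α ⟨s(u, v), h⟩).mul_mem_left r (hF u v h)
    simpa only [Pi.smul_apply, smul_eq_mul, mul_sub] using this

/-- The greatest common divisor of the edge labels along a walk `p`, for edge labels that are
elements of `R` (generators of principal ideals). -/
def walkGcd {V R : Type*} [CommRing R] [NormalizedGCDMonoid R] {G : SimpleGraph V}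
    (l : G.EdgeLabeling R) {u v : V} (p : G.Walk u v) : R :=
  Multiset.gcd (Multiset.ofList
    (p.edges.attach.map fun e => l ⟨e.1, p.edges_subset_edgeSet e.2⟩))

/-- The zero trails of the vertex `i` of a graph on the ordered vertices `0, …, n - 1`: the trails
(walks without repeated edges) that start at `i` and end at some vertex `j < i`. -/
def zeroTrails {n : ℕ} (G : SimpleGraph (Fin n)) (i : Fin n) : Set (Σ j : Fin n, G.Walk i j) :=
  {p | p.1 < i ∧ p.2.IsTrail}

theorem zeroTrails_finite {n : ℕ} (G : SimpleGraph (Fin n)) (i : Fin n) :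
    (zeroTrails G i).Finite := by
  classical
  have key : ∀ j : Fin n, {p : G.Walk i j | p.length < G.edgeFinset.card + 1}.Finite := fun j =>
    Set.toFinite _
  refine (Set.finite_iUnion fun j => (key j).image (Sigma.mk j)).subset ?_
  rintro ⟨j, p⟩ hp
  exact Set.mem_iUnion.2 ⟨j, p, Nat.lt_succ_of_le hp.2.length_le_card_edgeFinset, rfl⟩

/-- The element `𝓛_i`: the least common multiple, over all zero trails of the vertex `i`, of the
greatest common divisor of the edge labels on the trail. The lcm of the empty family is `1`; in
particular `𝓛 = 1` for the first vertex, which has no zero trails. -/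
noncomputable def trailLcm {n : ℕ} {R : Type*} [CommRing R] [NormalizedGCDMonoid R]
    {G : SimpleGraph (Fin n)} (l : G.EdgeLabeling R) (i : Fin n) : R :=
  (zeroTrails_finite G i).toFinset.lcm fun p => walkGcd l p.2

/-- The element `Q_G = ∏ 𝓛_i`. -/
noncomputable def graphQ {n : ℕ} {R : Type*} [CommRing R] [NormalizedGCDMonoid R]
    {G : SimpleGraph (Fin n)} (l : G.EdgeLabeling R) : R :=
  ∏ i : Fin n, trailLcm l i

/-- The spline matrix of `F 0, …, F (n - 1)`: column `c` lists the values of `F c`, the last vertex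
in the top row and the first vertex in the bottom row. -/
def splineMatrix {n : ℕ} {R : Type*} [CommRing R] {G : SimpleGraph (Fin n)}
    {α : G.EdgeLabeling (Ideal R)} (F : Fin n → splineModule G α) : Matrix (Fin n) (Fin n) R :=
  Matrix.of fun r c => (F c : Fin n → R) (Fin.rev r)

end GenSpline

/-!
`Q_G` is the greatest common divisor of the determinants of all families of `n` splines, and a
family with nonzero determinant is a basis exactly when its determinant divides all the others
(Cramer's rule).

To see that `Q_G` divides a determinant, choose a zero trail, from `i` to some `j < i`, for each
vertex `i` that is to contribute. All splines agree at `i` and `j` modulo the gcd of the labels on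
the trail, so subtracting row `j` from row `i` makes row `i` divisible by that gcd. The lcm over
the trails of each vertex is taken one vertex at a time.

Conversely, for a set `S` of vertices the indicator function of `S` times the lcm of the labels on
the edges leaving `S` is a spline. Choosing for each `i` a set with least element `i` gives a
triangular matrix, so a common divisor of all determinants divides the product over `i` of the gcds
of these cut lcms. That such a gcd divides `𝓛_i` is a bottleneck duality: let `d` divide all the cut
lcms at `i`. If the edges with label divisible by `d` connect `i` to some `j < i`, they contain a
zero trail whose gcd `d` divides. Otherwise the vertices connected to `i` by such edges form a set
`S` with least element `i`; since divisibility in a GCD domain is distributive, `d` is the lcm of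
the elements `gcd d (l e)` for the edges `e` leaving `S`, and each of these divides strictly more
labels than `d`.
-/

namespace GenSpline

open scoped Pointwise

section Divisibility

variable {M : Type*} [CommMonoidWithZero M]

theorem dvd_mul_gcd [GCDMonoid M] {k x y z : M} (hy : k ∣ x * y) (hz : k ∣ x * z) :
    k ∣ x * gcd y z :=
  (dvd_gcd hy hz).trans (gcd_mul_left' x y z).dvd

-- Multiplied by the gcd `g` of its two entries, the lcm becomes `gcd d a * gcd d b`, whose four
-- expanded products `d * d`, `d * b`, `a * d`, `a * b` are all multiples of `d * g`.
theorem dvd_lcm_gcd_gcd [GCDMonoid M] {d a b : M} (h : d ∣ lcm a b) :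
    d ∣ lcm (gcd d a) (gcd d b) := by
  set g := gcd (gcd d a) (gcd d b)
  have hg_left : g ∣ gcd d a := gcd_dvd_left _ _
  have hg_right : g ∣ gcd d b := gcd_dvd_right _ _
  have hab : d * g ∣ b * a :=
    calc d * g ∣ lcm a b * gcd a b :=
          mul_dvd_mul h (gcd_dvd_gcd (gcd_dvd_right d a) (gcd_dvd_right d b))
      _ = gcd a b * lcm a b := mul_comm _ _
      _ ∣ a * b := (gcd_mul_lcm a b).dvd
      _ = b * a := mul_comm _ _
  have hb : d * g ∣ gcd d a * b :=
    calc d * g ∣ b * gcd d a :=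
          dvd_mul_gcd (mul_comm d b ▸ mul_dvd_mul_left d (hg_right.trans (gcd_dvd_right d b))) hab
      _ = gcd d a * b := mul_comm _ _
  have hprod : g * d ∣ g * lcm (gcd d a) (gcd d b) :=
    calc g * d = d * g := mul_comm _ _
      _ ∣ gcd d a * gcd d b := dvd_mul_gcd (mul_comm d _ ▸ mul_dvd_mul_left d hg_left) hb
      _ ∣ g * lcm (gcd d a) (gcd d b) := (gcd_mul_lcm _ _).symm.dvd
  by_cases hg : g = 0
  · have hda : gcd d a = 0 := ((gcd_eq_zero_iff _ _).1 hg).1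
    simp [hda, lcm_zero_left]
  · exact (mul_dvd_mul_iff_left hg).1 hprod

theorem dvd_finset_lcm_gcd [NormalizedGCDMonoid M] {β : Type*} {s : Finset β} {f : β → M} {d : M}
    (h : d ∣ s.lcm f) : d ∣ s.lcm fun b => gcd d (f b) := by
  classical
  induction s using Finset.induction_on generalizing d with
  | empty => simpa using h
  | insert a s _ ih =>
    rw [Finset.lcm_insert] at h ⊢
    refine (dvd_lcm_gcd_gcd h).trans (lcm_dvd_lcm dvd_rfl ?_)
    calc gcd d (s.lcm f) ∣ s.lcm fun b => gcd (gcd d (s.lcm f)) (f b) := ih (gcd_dvd_right _ _)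
      _ ∣ s.lcm fun b => gcd d (f b) :=
        Finset.lcm_mono_fun fun b _ => gcd_dvd_gcd (gcd_dvd_left _ _) dvd_rfl

theorem finset_lcm_mul_dvd [NormalizedGCDMonoid M] {β : Type*} {s : Finset β} {f : β → M} {c m : M}
    (hc : c ∣ m) (h : ∀ b ∈ s, f b * c ∣ m) : s.lcm f * c ∣ m := by
  obtain ⟨k, rfl⟩ := hc
  rw [mul_comm c k] at h ⊢
  by_cases hc : c = 0
  · simp [hc]
  · refine mul_dvd_mul_right (Finset.lcm_dvd fun b hb => ?_) c
    exact (mul_dvd_mul_iff_right hc).1 (h b hb)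

theorem dvd_finset_gcd_mul [NormalizedGCDMonoid M] {β : Type*} {s : Finset β} {f : β → M} {c m : M}
    (h : ∀ b ∈ s, m ∣ f b * c) : m ∣ s.gcd f * c :=
  (Finset.dvd_gcd h).trans (s.gcd_mul_right' f c).dvd

-- Distributes a product over lcms when `P` is `(· ∣ m)` and `L i` is the lcm of `T i`, and over
-- gcds when `P` is `(m ∣ ·)` and `L i` is the gcd of `T i`.
theorem prod_of_forall_mem_prod {ι N : Type*} [CommMonoid N] {P : N → Prop} {s : Finset ι}
    {T : ι → Set N} {L : ι → N}
    (hL : ∀ i ∈ s, ∀ c, (∀ t ∈ T i, P (t * c)) → P (L i * c))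
    (h : ∀ t ∈ ∏ i ∈ s, T i, P t) : P (∏ i ∈ s, L i) := by
  classical
  induction s using Finset.induction_on generalizing P with
  | empty => simpa using h
  | insert a s ha ih =>
    rw [Finset.prod_insert ha] at h ⊢
    refine hL a (Finset.mem_insert_self a s) _ fun t ht => ?_
    refine ih (P := fun y => P (t * y)) (fun i hi c hc => ?_)
      fun y hy => h _ (Set.mul_mem_mul ht hy)
    rw [mul_left_comm]
    refine hL i (Finset.mem_insert_of_mem hi) _ fun y hy => ?_
    rw [mul_left_comm]
    exact hc y hy

end Divisibility

section Determinant

open Matrix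

variable {ι R : Type*} [CommRing R]

/-- The matrix of a family of elements of a submodule of `ι → R`: column `c` lists the coordinates
of `F c`. For splines it is `splineMatrix` with the first vertex in the top row, which makes the
matrix of a flow-up family lower triangular. -/
def valueMatrix {κ : Type*} {N : Submodule R (ι → R)} (F : κ → N) : Matrix ι κ R :=
  of fun i c => (F c : ι → R) i

variable [Fintype ι]

theorem prod_dvd_det_of_forall_dvd [DecidableEq ι] {A : Matrix ι ι R} {x : ι → R}
    (h : ∀ i j, x i ∣ A i j) : ∏ i, x i ∣ A.det := by
  choose b hb using h
  have hA : A = of fun i j => x i * of b i j := by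
    ext i j
    exact hb i j
  rw [hA, det_mul_column]
  exact dvd_mul_right _ _

theorem prod_dvd_det_of_forall_dvd_row_sub [LinearOrder ι] {A : Matrix ι ι R} {x : ι → R}
    (h : ∀ i, x i = 1 ∨ ∃ j < i, ∀ c, x i ∣ A i c - A j c) : ∏ i, x i ∣ A.det := by
  have rowOp : ∀ i, ∃ u : ι → R, u i = 1 ∧ (∀ j, i < j → u j = 0) ∧ ∀ c, x i ∣ (u ᵥ* A) c := by
    intro i
    rcases h i with hi | ⟨j, hji, hdvd⟩
    · exact ⟨Pi.single i 1, by simp, fun k hk => by simp [hk.ne'], by simp [hi]⟩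
    · refine ⟨Pi.single i 1 - Pi.single j 1, by simp [hji.ne'], fun k hk => ?_, fun c => ?_⟩
      · simp [hk.ne', (hji.trans hk).ne']
      · simpa [sub_vecMul] using hdvd c
  choose U hdiag hlower hdvd using rowOp
  have hU : det (of U) = 1 := by
    rw [det_of_isLowerTriangular (of U) fun i j hij => hlower i j hij]
    simp [hdiag]
  calc ∏ i, x i ∣ (of U * A).det := prod_dvd_det_of_forall_dvd fun i c => hdvd i c
    _ = A.det := by rw [det_mul, hU, one_mul]

variable {N : Submodule R (ι → R)}

theorem valueMatrix_mulVec (F : ι → N) (g : ι → R) :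
    valueMatrix F *ᵥ g = (∑ c, g c • F c : N) := by
  ext i
  simp [valueMatrix, mulVec, dotProduct, mul_comm]

variable [DecidableEq ι]

theorem det_valueMatrix_basis_dvd (b : Module.Basis ι R N) (H : ι → N) :
    (valueMatrix b).det ∣ (valueMatrix H).det := by
  have hH : valueMatrix H = valueMatrix b * b.toMatrix H := by
    ext i c
    have := congrFun (valueMatrix_mulVec b fun k => b.toMatrix H k c) i
    rw [b.sum_toMatrix_smul_self] at this
    exact this.symm
  rw [hH, det_mul]
  exact dvd_mul_right _ _

theorem det_valueMatrix_smul (F : ι → N) (H : N) :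
    (valueMatrix F).det • H = ∑ c, (valueMatrix (Function.update F c H)).det • F c := by
  have hcramer : ∀ c, (valueMatrix F).cramer H c = (valueMatrix (Function.update F c H)).det := by
    intro c
    rw [cramer_apply]
    congr 1
    ext i k
    by_cases hk : k = c
    · subst hk
      simp [valueMatrix]
    · simp [valueMatrix, hk]
  ext1
  simp only [← hcramer, ← valueMatrix_mulVec, mulVec_cramer, Submodule.coe_smul]

theorem linearIndependent_of_det_valueMatrix {F : ι → N}
    (hF : (valueMatrix F).det ∈ nonZeroDivisors R) : LinearIndependent R F := by
  rw [Fintype.linearIndependent_iff]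
  intro g hg
  have hmul : valueMatrix F *ᵥ g = 0 := by rw [valueMatrix_mulVec, hg, Submodule.coe_zero]
  exact congrFun (eq_zero_of_det_mem_nonZeroDivisors_of_mulVec_eq_zero hF hmul)

theorem exists_basis_of_det_valueMatrix_dvd {F : ι → N}
    (hF : (valueMatrix F).det ∈ nonZeroDivisors R)
    (hdvd : ∀ H : ι → N, (valueMatrix F).det ∣ (valueMatrix H).det) :
    ∃ b : Module.Basis ι R N, ∀ i, b i = F i := by
  have hspan : ⊤ ≤ Submodule.span R (Set.range F) := by
    intro H _
    choose x hx using fun c => hdvd (Function.update F c H)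
    have hsmul : (valueMatrix F).det • H = (valueMatrix F).det • ∑ c, x c • F c := by
      simp only [det_valueMatrix_smul F H, hx, mul_smul, Finset.smul_sum]
    have hH : H = ∑ c, x c • F c := by
      ext i
      have := congrArg (fun K : N => (K : ι → R) i) hsmul
      exact (mul_cancel_left_mem_nonZeroDivisors hF).1 this
    rw [hH]
    exact Submodule.sum_mem _ fun c _ => Submodule.smul_mem _ _ (Submodule.subset_span ⟨c, rfl⟩)
  exact ⟨.mk (linearIndependent_of_det_valueMatrix hF) hspan, fun i => by simp⟩

end Determinant

section Graph

open SimpleGraph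

variable {V : Type*} {G : SimpleGraph V} {u v : V}

section DvdGraph

variable {M : Type*} [Semigroup M] {l : G.EdgeLabeling M} {d d' : M}

/-- The spanning subgraph of `G` whose edges are those with label divisible by `d`. -/
def dvdGraph (l : G.EdgeLabeling M) (d : M) : SimpleGraph V where
  Adj u v := ∃ h : G.Adj u v, d ∣ l ⟨s(u, v), h⟩
  symm := ⟨fun u v ⟨h, hd⟩ =>
    ⟨h.symm, (Subtype.ext Sym2.eq_swap : (⟨s(v, u), h.symm⟩ : G.edgeSet) = ⟨s(u, v), h⟩) ▸ hd⟩⟩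
  loopless := ⟨fun _ ⟨h, _⟩ => G.irrefl h⟩

theorem mem_edgeSet_dvdGraph (e : G.edgeSet) : (e : Sym2 V) ∈ (dvdGraph l d).edgeSet ↔ d ∣ l e := by
  obtain ⟨e, he⟩ := e
  induction e with
  | h u v => exact ⟨fun ⟨_, hd⟩ => hd, fun hd => ⟨he, hd⟩⟩

theorem dvdGraph_le (l : G.EdgeLabeling M) (d : M) : dvdGraph l d ≤ G :=
  fun _ _ h => h.1

theorem dvdGraph_anti (l : G.EdgeLabeling M) (h : d ∣ d') : dvdGraph l d' ≤ dvdGraph l d :=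
  fun _ _ ⟨huv, hd⟩ => ⟨huv, h.trans hd⟩

end DvdGraph

theorem dvdGraph_zero {M : Type*} [SemigroupWithZero M] {l : G.EdgeLabeling M}
    (hl : ∀ e, l e ≠ 0) : dvdGraph l 0 = ⊥ :=
  eq_bot_iff.2 fun _ _ ⟨_, h⟩ => hl _ (zero_dvd_iff.1 h)

section Spline

variable {R : Type*} [CommRing R] {l : G.EdgeLabeling R} {d : R}

theorem dvd_sub_of_reachable_dvdGraph {α : G.EdgeLabeling (Ideal R)}
    (hl : ∀ e, α e = Ideal.span {l e}) {F : V → R} (hF : F ∈ splineModule G α)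
    (h : (dvdGraph l d).Reachable u v) : d ∣ F u - F v := by
  obtain ⟨p⟩ := h
  induction p with
  | nil => simp
  | @cons u v w huv _ ih =>
    obtain ⟨hadj, hd⟩ := huv
    have huv : l ⟨s(u, v), hadj⟩ ∣ F u - F v := by
      rw [← Ideal.mem_span_singleton, ← hl]
      exact hF u v hadj
    simpa using dvd_add (hd.trans huv) ih

variable [NormalizedGCDMonoid R]

theorem dvd_walkGcd_iff {p : G.Walk u v} :
    d ∣ walkGcd l p ↔ ∀ e ∈ p.edges, e ∈ (dvdGraph l d).edgeSet := by
  simp only [walkGcd, Multiset.dvd_gcd, Multiset.mem_coe, List.mem_map, List.mem_attach, true_and,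
    Subtype.exists, forall_exists_index]
  constructor
  · exact fun h e he => (mem_edgeSet_dvdGraph ⟨e, p.edges_subset_edgeSet he⟩).2 (h _ e he rfl)
  · rintro h _ e he rfl
    exact (mem_edgeSet_dvdGraph _).1 (h e he)

theorem reachable_dvdGraph_iff :
    (dvdGraph l d).Reachable u v ↔ ∃ p : G.Walk u v, p.IsTrail ∧ d ∣ walkGcd l p := by
  constructor
  · intro h
    obtain ⟨p, hp⟩ := h.exists_isPath
    refine ⟨p.mapLe (dvdGraph_le l d), hp.isTrail.mapLe _, dvd_walkGcd_iff.2 fun e he => ?_⟩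
    rw [Walk.edges_mapLe_eq_edges] at he
    exact p.edges_subset_edgeSet he
  · rintro ⟨p, -, hp⟩
    exact ⟨p.transfer _ (dvd_walkGcd_iff.1 hp)⟩

end Spline

section Cut

/-- The edges of `G` with exactly one endpoint in `S`. -/
def cutEdges (G : SimpleGraph V) (S : Set V) : Set G.edgeSet :=
  {e | ∃ u ∈ S, ∃ v ∉ S, (e : Sym2 V) = s(u, v)}

variable [Finite V]

/-- The least common multiple of the labels on the edges leaving `S`, the smallest multiplier that
turns the indicator function of `S` into a spline. -/
noncomputable def cutLcm {M : Type*} [CommMonoidWithZero M] [NormalizedGCDMonoid M]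
    (l : G.EdgeLabeling M) (S : Set V) : M :=
  (cutEdges G S).toFinite.toFinset.lcm l

theorem dvd_cutLcm {M : Type*} [CommMonoidWithZero M] [NormalizedGCDMonoid M]
    {l : G.EdgeLabeling M} {S : Set V} (h : G.Adj u v) (hu : u ∈ S) (hv : v ∉ S) :
    l ⟨s(u, v), h⟩ ∣ cutLcm l S :=
  Finset.dvd_lcm ((Set.Finite.mem_toFinset _).2 ⟨u, hu, v, hv, rfl⟩)

theorem indicator_cutLcm_mem_splineModule {R : Type*} [CommRing R] [NormalizedGCDMonoid R]
    {l : G.EdgeLabeling R} {α : G.EdgeLabeling (Ideal R)}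
    (hl : ∀ e, α e = Ideal.span {l e}) (S : Set V) :
    S.indicator (fun _ => cutLcm l S) ∈ splineModule G α := by
  intro u v h
  rw [hl, Ideal.mem_span_singleton]
  by_cases hu : u ∈ S <;> by_cases hv : v ∈ S
  · simp [hu, hv]
  · simpa [hu, hv] using dvd_cutLcm h hu hv
  · simpa [hu, hv, Sym2.eq_swap] using dvd_cutLcm h.symm hv hu
  · simp [hu, hv]

end Cut

end Graph

section Trail

variable {n : ℕ} {R : Type*} [CommRing R] [NormalizedGCDMonoid R] {G : SimpleGraph (Fin n)}
  {l : G.EdgeLabeling R} {i j : Fin n} {d : R}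

theorem dvd_trailLcm (hj : j < i) (h : (dvdGraph l d).Reachable i j) : d ∣ trailLcm l i := by
  obtain ⟨p, hp, hd⟩ := reachable_dvdGraph_iff.1 h
  have hmem : ⟨j, p⟩ ∈ (zeroTrails_finite G i).toFinset := by simpa [zeroTrails] using ⟨hj, hp⟩
  exact hd.trans (Finset.dvd_lcm (f := fun p : Σ j, G.Walk i j => walkGcd l p.2) hmem)

theorem trailLcm_mul_dvd {c m : R} (hc : c ∣ m)
    (h : ∀ j < i, ∀ d, (dvdGraph l d).Reachable i j → d * c ∣ m) : trailLcm l i * c ∣ m := by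
  refine finset_lcm_mul_dvd hc fun ⟨j, p⟩ hp => ?_
  obtain ⟨hj, hp⟩ := (Set.Finite.mem_toFinset _).1 hp
  exact h j hj _ (reachable_dvdGraph_iff.2 ⟨p, hp, dvd_rfl⟩)

theorem trailLcm_ne_zero [Nontrivial R] (hl : ∀ e, l e ≠ 0) (i : Fin n) : trailLcm l i ≠ 0 := by
  rw [trailLcm, Finset.lcm_ne_zero_iff]
  rintro ⟨j, p⟩ hp h0
  obtain ⟨hj, hp⟩ := (Set.Finite.mem_toFinset _).1 hp
  have hreach : (dvdGraph l 0).Reachable i j := reachable_dvdGraph_iff.2 ⟨p, hp, h0.symm.dvd⟩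
  rw [dvdGraph_zero hl, SimpleGraph.reachable_bot] at hreach
  exact hj.ne' hreach

theorem dvd_trailLcm_of_forall_dvd_cutLcm (h : ∀ S : Set (Fin n), IsLeast S i → d ∣ cutLcm l S) :
    d ∣ trailLcm l i := by
  induction hH : dvdGraph l d using WellFoundedGT.induction generalizing d with
  | ind H ih =>
    subst hH
    by_cases hreach : ∃ j < i, (dvdGraph l d).Reachable i j
    · obtain ⟨j, hj, hij⟩ := hreach
      exact dvd_trailLcm hj hij
    · push Not at hreach
      have hS : IsLeast {v | (dvdGraph l d).Reachable i v} i :=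
        ⟨.rfl, fun v hv => not_lt.1 fun hvi => hreach v hvi hv⟩
      refine (dvd_finset_lcm_gcd (h _ hS)).trans (Finset.lcm_dvd fun e he => ?_)
      obtain ⟨u, hu, v, hv, he⟩ := (Set.Finite.mem_toFinset _).1 he
      have hlt : dvdGraph l d < dvdGraph l (gcd d (l e)) := by
        refine lt_of_le_of_ne (dvdGraph_anti l (gcd_dvd_left _ _)) fun heq => ?_
        have hadj : (e : Sym2 (Fin n)) ∈ (dvdGraph l d).edgeSet :=
          heq ▸ (mem_edgeSet_dvdGraph e).2 (gcd_dvd_right _ _)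
        rw [he, SimpleGraph.mem_edgeSet] at hadj
        exact hv (hu.trans hadj.reachable)
      exact ih _ hlt (fun S hS => (gcd_dvd_left _ _).trans (h S hS)) rfl

theorem dvd_trailLcm_mul {c : R}
    (h : ∀ S : Set (Fin n), IsLeast S i → d ∣ cutLcm l S * c) : d ∣ trailLcm l i * c := by
  set s := (Set.toFinite {S : Set (Fin n) | IsLeast S i}).toFinset with hs
  have hcut : s.gcd (cutLcm l) ∣ trailLcm l i :=
    dvd_trailLcm_of_forall_dvd_cutLcm fun S hS => Finset.gcd_dvd (by simpa [hs] using hS)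
  calc d ∣ s.gcd (cutLcm l) * c := dvd_finset_gcd_mul fun S hS => h S (by simpa [hs] using hS)
    _ ∣ trailLcm l i * c := mul_dvd_mul_right hcut c

end Trail

section Criterion

variable {n : ℕ} {R : Type*} [CommRing R] {G : SimpleGraph (Fin n)} {α : G.EdgeLabeling (Ideal R)}

theorem associated_det_splineMatrix (F : Fin n → splineModule G α) :
    Associated (splineMatrix F).det (valueMatrix F).det := by
  have hperm : splineMatrix F = (valueMatrix F).submatrix Fin.revPerm id := rfl
  rw [hperm, Matrix.det_permute]
  exact associated_unit_mul_left _ _ ((Equiv.Perm.sign _).isUnit.map (Int.castRingHom R))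

variable [NormalizedGCDMonoid R] {l : G.EdgeLabeling R}

theorem graphQ_ne_zero [Nontrivial R] (hl : ∀ e, l e ≠ 0) : graphQ l ≠ 0 :=
  Finset.prod_ne_zero_iff.2 fun i _ => trailLcm_ne_zero hl i

theorem graphQ_dvd_det (hl : ∀ e, α e = Ideal.span {l e}) (F : Fin n → splineModule G α) :
    graphQ l ∣ (valueMatrix F).det := by
  let T (i : Fin n) : Set R := {d | d = 1 ∨ ∃ j < i, (dvdGraph l d).Reachable i j}
  refine prod_of_forall_mem_prod (P := (· ∣ (valueMatrix F).det)) (T := T)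
    (fun i _ c h => ?_) fun t ht => ?_
  · exact trailLcm_mul_dvd (by simpa using h 1 (.inl rfl)) fun j hj d hd => h d (.inr ⟨j, hj, hd⟩)
  · obtain ⟨x, hx, rfl⟩ := (Set.mem_fintype_prod _ _).1 ht
    refine prod_dvd_det_of_forall_dvd_row_sub fun i => (hx i).imp_right ?_
    rintro ⟨j, hj, hij⟩
    exact ⟨j, hj, fun c => dvd_sub_of_reachable_dvdGraph hl (F c).2 hij⟩

theorem dvd_graphQ (hl : ∀ e, α e = Ideal.span {l e}) {d : R}
    (h : ∀ H : Fin n → splineModule G α, d ∣ (valueMatrix H).det) : d ∣ graphQ l := by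
  refine prod_of_forall_mem_prod (P := (d ∣ ·)) (T := fun i => cutLcm l '' {S | IsLeast S i})
    (fun i _ c hc => dvd_trailLcm_mul fun S hS => hc _ ⟨S, hS, rfl⟩) fun t ht => ?_
  obtain ⟨x, hx, rfl⟩ := (Set.mem_fintype_prod _ _).1 ht
  choose S hS hx using hx
  let H (i : Fin n) : splineModule G α := ⟨_, indicator_cutLcm_mem_splineModule hl (S i)⟩
  have hH (i c : Fin n) : valueMatrix H i c = (S c).indicator (fun _ => cutLcm l (S c)) i := rfl
  have hlower : (valueMatrix H).IsLowerTriangular := fun i c hic => by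
    have hi : i ∉ S c := fun hi => ((hS c).2 hi).not_gt hic
    rw [hH, Set.indicator_of_notMem hi]
  have hdiag (i : Fin n) : valueMatrix H i i = x i := by
    rw [hH, Set.indicator_of_mem (hS i).1, hx]
  have hdet : (valueMatrix H).det = ∏ i, x i := by
    rw [Matrix.det_of_isLowerTriangular _ hlower]
    exact Finset.prod_congr rfl fun i _ => hdiag i
  exact hdet ▸ h H

theorem exists_basis_iff_associated_det_splineMatrix [Nontrivial R]
    (hl : ∀ e, α e = Ideal.span {l e}) (hl0 : ∀ e, l e ≠ 0) (F : Fin n → splineModule G α) :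
    (∃ b : Module.Basis (Fin n) R (splineModule G α), ∀ i, b i = F i) ↔
      Associated (graphQ l) (splineMatrix F).det := by
  have hdet := associated_det_splineMatrix F
  constructor
  · rintro ⟨b, hb⟩
    obtain rfl : ⇑b = F := funext hb
    have hQ : graphQ l ∣ (valueMatrix b).det := graphQ_dvd_det hl b
    exact (associated_of_dvd_dvd hQ (dvd_graphQ hl (det_valueMatrix_basis_dvd b))).trans hdet.symm
  · intro h
    have hF : Associated (graphQ l) (valueMatrix F).det := h.trans hdet
    have hF0 : (valueMatrix F).det ≠ 0 := hF.ne_zero_iff.1 (graphQ_ne_zero hl0)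
    exact exists_basis_of_det_valueMatrix_dvd (mem_nonZeroDivisors_of_ne_zero hF0) fun H =>
      hF.symm.dvd.trans (graphQ_dvd_det hl H)

end Criterion

end GenSpline

/-- Determinantal basis criterion for generalized splines over a GCD domain. The GCD domain is a
domain with `NormalizedGCDMonoid`, i.e. with some choice of gcds and lcms (every GCD domain has one);
the labels `α e` are nonzero principal ideals, and `l e` is any generator of `α e`. -/
theorem mainTheorem1 {R : Type*} [CommRing R] [IsDomain R] [NormalizedGCDMonoid R] {n : ℕ}
    (G : SimpleGraph (Fin n)) (α : G.EdgeLabeling (Ideal R)) (l : G.EdgeLabeling R)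
    (hl : ∀ e, α e = Ideal.span {l e}) (hα : ∀ e, α e ≠ ⊥)
    (F : Fin n → GenSpline.splineModule G α) :
    (∃ b : Module.Basis (Fin n) R (GenSpline.splineModule G α), ∀ i, b i = F i) ↔
      ∃ r : Rˣ, (GenSpline.splineMatrix F).det = r * GenSpline.graphQ l := by
  have hl0 : ∀ e, l e ≠ 0 := fun e he => hα e (by rw [hl, he, Ideal.span_singleton_eq_bot])
  rw [GenSpline.exists_basis_iff_associated_det_splineMatrix hl hl0]
  exact exists_congr fun r => by rw [eq_comm, mul_comm]
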